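/- Let $E$ be a real Banach lattice. A sequence $(z_n)$ in $E$ is unbounded order null (uo-null) if for every $y\in E^+$ the sequence $|z_n|\wedge y$ converges to $0$ in order, i.e. there is a net $(d_\beta)$ in $E$ with $d_\beta\downarrow 0$ such that for every $\beta$ one has $|z_n|\wedge y\le d_\beta$ for all sufficiently large $n$. Let $T:E\to E$ be a bounded linear operator which is uo-demi Dunford–Pettis, that is: whenever $(x_n)$ is a weakly null sequence in $E$ such that $(x_n-T(x_n))$ is uo-null, then $\|x_n\|\to 0$. Suppose that the closed subspace $K=\mathrm{Ker}(\mathrm{Id}_E-T)$ is a Riesz space, i.e. in the order induced by $E$ any two elements of $K$ have a supremum and an infimum in $K$ (for instance, $K$ is a Riesz subspace of $E$). Then $K$, regarded as a Banach lattice in its own right, has the positive Schur property: every weakly null sequence of positive elements of $K$ converges to $0$ in norm. Precisely, every sequence of positive elements of $K$ that is weakly null in $K$ is norm null for the norm of $E$; moreover, there is a norm on $K$, equivalent to the norm of $E$ and equal to it if $K$ is a Riesz subspace of $E$, under which $K$ with its induced order is a Banach lattice, and this Banach lattice has the positive Schur property. -/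

import Mathlib

open Filter Topology

universe u

/-- `(x n)` converges weakly to `0` in the normed space `X`. -/
def WeaklyNull {X : Type*} [NormedAddCommGroup X] [NormedSpace ℝ X] (x : ℕ → X) : Prop :=
  ∀ f : StrongDual ℝ X, Tendsto (fun n => f (x n)) atTop (𝓝 0)

/-- Order convergence of a net `x` to `a` in a vector lattice: some net `y_β ↓ 0` (with its own
index set) satisfies: for every `β`, eventually `|x i - a| ≤ y_β`. Only the range `D` of
`(y_β)` matters, and the ranges of nets decreasing to `0` are the nonempty, downward directed
sets with infimum `0`. -/
def OrderConverges {E ι : Type*} [AddCommGroup E] [Lattice E] [Preorder ι]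
    (x : ι → E) (a : E) : Prop :=
  ∃ D : Set E, D.Nonempty ∧ DirectedOn (· ≥ ·) D ∧ IsGLB D 0 ∧
    ∀ d ∈ D, ∀ᶠ i in atTop, |x i - a| ≤ d

/-- Unbounded order convergence: `|x i - a| ⊓ y` order converges to `0` for every `y ≥ 0`. -/
def UoConverges {E ι : Type*} [AddCommGroup E] [Lattice E] [Preorder ι]
    (x : ι → E) (a : E) : Prop :=
  ∀ y : E, 0 ≤ y → OrderConverges (fun i => |x i - a| ⊓ y) 0

/-- Unbounded order demi Dunford–Pettis operators. -/
def UoDemiDunfordPettis {E : Type*} [NormedAddCommGroup E] [NormedSpace ℝ E] [Lattice E]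
    (T : E →L[ℝ] E) : Prop :=
  ∀ x : ℕ → E, WeaklyNull x → UoConverges (fun n => x n - T (x n)) 0 →
    Tendsto (fun n => ‖x n‖) atTop (𝓝 0)

/-- An ordered real vector space is a Riesz space if any two elements have a supremum and an
infimum. -/
def IsRieszSpace (V : Type*) [AddCommGroup V] [Module ℝ V] [PartialOrder V]
    [IsOrderedAddMonoid V] [IsOrderedModule ℝ V] : Prop :=
  ∀ x y : V, (∃ z, IsLUB {x, y} z) ∧ (∃ z, IsGLB {x, y} z)

/-- A linear subspace closed under the lattice operations of the ambient space. -/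
def IsRieszSubspace {E : Type*} [AddCommGroup E] [Module ℝ E] [Lattice E]
    (K : Submodule ℝ E) : Prop :=
  ∀ x ∈ K, ∀ y ∈ K, x ⊔ y ∈ K ∧ x ⊓ y ∈ K

/-- Every weakly null sequence with positive terms is norm null. -/
def PositiveSchurProperty (X : Type*) [NormedAddCommGroup X] [NormedSpace ℝ X]
    [PartialOrder X] : Prop :=
  ∀ x : ℕ → X, (∀ n, 0 ≤ x n) → WeaklyNull x → Tendsto (fun n => ‖x n‖) atTop (𝓝 0)

/-- The fixed space `Ker (Id - T)`, with the linear structure, norm and order of `E`. -/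
abbrev fixedSpace {E : Type*} [NormedAddCommGroup E] [NormedSpace ℝ E] (T : E →L[ℝ] E) :
    Submodule ℝ E :=
  LinearMap.ker ((ContinuousLinearMap.id ℝ E - T : E →L[ℝ] E) : E →ₗ[ℝ] E)

/-- A subspace of an ordered vector space is an ordered vector space in the induced order. -/
instance submoduleIsOrderedModule {E : Type*} [AddCommGroup E] [Module ℝ E] [PartialOrder E]
    [IsOrderedAddMonoid E] [IsOrderedModule ℝ E] (K : Submodule ℝ E) : IsOrderedModule ℝ K where
  smul_le_smul_of_nonneg_left a ha x y h := by
    have h' : (x : E) ≤ y := h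
    change a • (x : E) ≤ a • (y : E)
    exact smul_le_smul_of_nonneg_left h' ha
  smul_le_smul_of_nonneg_right x hx a b h := by
    have hx' : (0 : E) ≤ x := hx
    change a • (x : E) ≤ b • (x : E)
    exact smul_le_smul_of_nonneg_right h hx'

/-!
The operator `Id - T` annihilates every sequence in `K = Ker (Id - T)`, and the zero sequence is
uo-null, so the uo-demi Dunford–Pettis property makes every weakly null sequence in `K` norm null.

The norm of `K` is monotone on the positive cone. A vector lattice that is a Banach space with
closed order and monotone norm is complete for the solid norm `‖|x|‖` too, because the tails of an
absolutely convergent series obey `|∑ uₖ| ≤ ∑ |uₖ|`. Since `‖x‖ ≤ 3 * ‖|x|‖`, the open mapping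
theorem makes the two norms equivalent. In a Riesz subspace the modulus of `K` is that of `E`, and
the solid norm is the original one.
-/

theorem WeaklyNull.map {X Y : Type*} [NormedAddCommGroup X] [NormedSpace ℝ X]
    [NormedAddCommGroup Y] [NormedSpace ℝ Y] {x : ℕ → X} (hx : WeaklyNull x) (f : X →L[ℝ] Y) :
    WeaklyNull (fun n => f (x n)) :=
  fun g => hx (g.comp f)

theorem PositiveSchurProperty.of_isInducing {X Y : Type*} [NormedAddCommGroup X]
    [NormedSpace ℝ X] [PartialOrder X] [NormedAddCommGroup Y] [NormedSpace ℝ Y] [PartialOrder Y]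
    (hY : PositiveSchurProperty Y) (f : X →L[ℝ] Y) (hmono : Monotone f) (hf : IsInducing f) :
    PositiveSchurProperty X := by
  intro x hx hweak
  have hpos (n : ℕ) : 0 ≤ f (x n) := (map_zero f).ge.trans (hmono (hx n))
  have hnull := tendsto_zero_iff_norm_tendsto_zero.2 (hY _ hpos (hweak.map f))
  rw [← tendsto_zero_iff_norm_tendsto_zero, hf.tendsto_nhds_iff, map_zero]
  exact hnull

theorem orderConverges_const {E ι : Type*} [AddCommGroup E] [Lattice E] [Preorder ι] (a : E) :
    OrderConverges (fun _ : ι => a) a :=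
  ⟨{0}, Set.singleton_nonempty 0, directedOn_singleton 0, isGLB_singleton, by simp [abs]⟩

theorem uoConverges_const {E ι : Type*} [AddCommGroup E] [Lattice E] [Preorder ι] (a : E) :
    UoConverges (fun _ : ι => a) a := by
  intro y hy
  have hzero : |a - a| ⊓ y = 0 := by simpa [abs] using hy
  simpa only [hzero] using orderConverges_const (0 : E)

theorem UoDemiDunfordPettis.tendsto_norm_of_weaklyNull {E : Type*} [NormedAddCommGroup E]
    [NormedSpace ℝ E] [Lattice E] {T : E →L[ℝ] E} (hT : UoDemiDunfordPettis T)
    {x : ℕ → fixedSpace T} (hx : WeaklyNull x) : Tendsto (fun n => ‖x n‖) atTop (𝓝 0) := by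
  have hfix (n : ℕ) : (x n : E) - T (x n) = 0 := LinearMap.mem_ker.1 (x n).2
  refine hT (fun n => (x n : E)) (hx.map (fixedSpace T).subtypeL) ?_
  simpa only [hfix] using uoConverges_const (0 : E)

theorem abs_smul_of_posSMulMono {𝕜 V : Type*} [Field 𝕜] [LinearOrder 𝕜] [IsStrictOrderedRing 𝕜]
    [AddCommGroup V] [Module 𝕜 V] [Lattice V] [PosSMulMono 𝕜 V] (c : 𝕜) (x : V) :
    |c • x| = |c| • |x| := by
  have habs_of_pos {c : 𝕜} (hc : 0 < c) : |c • x| = c • |x| := by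
    simpa only [OrderIso.smulRight_apply, smul_neg] using!
      ((OrderIso.smulRight hc).map_sup x (-x)).symm
  rcases lt_trichotomy c 0 with hc | rfl | hc
  · rw [abs_of_neg hc, ← habs_of_pos (neg_pos.2 hc), neg_smul, abs_neg]
  · simp [abs]
  · rw [abs_of_pos hc, habs_of_pos hc]

section AbsSeries

variable {V : Type*} [AddCommGroup V] [Lattice V] [IsOrderedAddMonoid V] [TopologicalSpace V]
  [IsTopologicalAddGroup V] [OrderClosedTopology V]

theorem abs_tsum_le_tsum_abs {ι : Type*} {u : ι → V} (hu : Summable u)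
    (habs : Summable fun i => |u i|) : |∑' i, u i| ≤ ∑' i, |u i| := by
  refine abs_le'.2 ⟨hu.tsum_le_tsum (fun i => le_abs_self (u i)) habs, ?_⟩
  rw [← tsum_neg]
  exact hu.neg.tsum_le_tsum (fun i => neg_le_abs (u i)) habs

theorem abs_sum_range_sub_tsum_le {u : ℕ → V} (hu : Summable u)
    (habs : Summable fun k => |u k|) (n : ℕ) :
    |∑ k ∈ Finset.range n, u k - ∑' k, u k| ≤ ∑' k, |u (k + n)| := by
  rw [← hu.sum_add_tsum_nat_add n, sub_add_cancel_left, abs_neg]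
  exact abs_tsum_le_tsum_abs ((summable_nat_add_iff n).2 hu) ((summable_nat_add_iff n).2 habs)

end AbsSeries

/-- The lattice structure of a Riesz space, with chosen suprema and infima and the given order. -/
noncomputable abbrev IsRieszSpace.toLattice {V : Type*} [AddCommGroup V] [Module ℝ V]
    [PartialOrder V] [IsOrderedAddMonoid V] [IsOrderedModule ℝ V] (h : IsRieszSpace V) :
    Lattice V :=
  { (inferInstance : PartialOrder V) with
    sup := fun x y => (h x y).1.choose
    inf := fun x y => (h x y).2.choose
    le_sup_left := fun x y => (h x y).1.choose_spec.1 (by simp)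
    le_sup_right := fun x y => (h x y).1.choose_spec.1 (by simp)
    sup_le := fun x y z hx hy => (h x y).1.choose_spec.2 (by simp [hx, hy])
    inf_le_left := fun x y => (h x y).2.choose_spec.1 (by simp)
    inf_le_right := fun x y => (h x y).2.choose_spec.1 (by simp)
    le_inf := fun x y z hx hy => (h y z).2.choose_spec.2 (by simp [hx, hy]) }

theorem IsRieszSubspace.coe_eq_sup_of_isLUB {E : Type*} [AddCommGroup E] [Module ℝ E] [Lattice E]
    {K : Submodule ℝ E} (hK : IsRieszSubspace K) {x y z : K} (hz : IsLUB {x, y} z) :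
    (z : E) = (x : E) ⊔ y := by
  let s : K := ⟨(x : E) ⊔ y, (hK x x.2 y y.2).1⟩
  have hs : IsLUB {x, y} s := by
    simp only [isLUB_iff_le_iff, mem_upperBounds, Set.mem_insert_iff, Set.mem_singleton_iff,
      forall_eq_or_imp, forall_eq]
    exact fun w => sup_le_iff (a := (x : E))
  exact congrArg Subtype.val (hz.unique hs)

theorem IsRieszSubspace.norm_eq_of_isLUB {E : Type*} [NormedAddCommGroup E] [NormedSpace ℝ E]
    [Lattice E] [IsOrderedAddMonoid E] [HasSolidNorm E] {K : Submodule ℝ E}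
    (hK : IsRieszSubspace K) {x z : K} (hz : IsLUB {x, -x} z) : ‖z‖ = ‖x‖ := by
  have habs : (z : E) = |(x : E)| := hK.coe_eq_sup_of_isLUB hz
  rw [Submodule.coe_norm, habs, norm_abs_eq_norm, Submodule.coe_norm]

section MonotoneNorm

/-- The norm is monotone on the positive cone. Unlike `HasSolidNorm` this makes sense without
lattice operations, and is inherited by every subspace. -/
class HasMonotoneNorm (F : Type*) [NormedAddCommGroup F] [PartialOrder F] : Prop where
  norm_le_norm : ∀ ⦃x y : F⦄, 0 ≤ x → x ≤ y → ‖x‖ ≤ ‖y‖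

instance HasMonotoneNorm.of_hasSolidNorm {E : Type*} [NormedAddCommGroup E] [Lattice E]
    [IsOrderedAddMonoid E] [HasSolidNorm E] : HasMonotoneNorm E where
  norm_le_norm x y hx hxy :=
    norm_le_norm_of_abs_le_abs (by rwa [abs_of_nonneg hx, abs_of_nonneg (hx.trans hxy)])

instance HasMonotoneNorm.submodule {R E : Type*} [Ring R] [NormedAddCommGroup E] [Module R E]
    [PartialOrder E] [HasMonotoneNorm E] (K : Submodule R E) : HasMonotoneNorm K where
  norm_le_norm x y hx hxy := HasMonotoneNorm.norm_le_norm (x := (x : E)) (y := y) hx hxy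

variable {F : Type*} [NormedAddCommGroup F] [Lattice F] [IsOrderedAddMonoid F] [HasMonotoneNorm F]

theorem norm_abs_le_norm_of_abs_le {x y : F} (h : |x| ≤ y) : ‖|x|‖ ≤ ‖y‖ :=
  HasMonotoneNorm.norm_le_norm (abs_nonneg x) h

theorem norm_le_three_mul_norm_abs (x : F) : ‖x‖ ≤ 3 * ‖|x|‖ := by
  have hnonneg : 0 ≤ x + |x| := neg_le_iff_add_nonneg'.1 (neg_le_abs x)
  calc ‖x‖ = ‖(x + |x|) - |x|‖ := by rw [add_sub_cancel_right]
    _ ≤ ‖x + |x|‖ + ‖|x|‖ := norm_sub_le _ _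
    _ ≤ ‖|x| + |x|‖ + ‖|x|‖ := by
      gcongr
      exact HasMonotoneNorm.norm_le_norm hnonneg (by gcongr; exact le_abs_self x)
    _ ≤ (‖|x|‖ + ‖|x|‖) + ‖|x|‖ := by gcongr; exact norm_add_le _ _
    _ = 3 * ‖|x|‖ := by ring

end MonotoneNorm

/-- The vector lattice `F`, renormed by `x ↦ ‖|x|‖`. It is a type synonym because `F` keeps its
own norm. -/
def WithAbsNorm (F : Type*) : Type _ := F

namespace WithAbsNorm

variable {F : Type*}

instance [AddCommGroup F] : AddCommGroup (WithAbsNorm F) := inferInstanceAs (AddCommGroup F)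

instance [Lattice F] : Lattice (WithAbsNorm F) := inferInstanceAs (Lattice F)

instance [AddCommGroup F] [Module ℝ F] : Module ℝ (WithAbsNorm F) := inferInstanceAs (Module ℝ F)

instance [AddCommGroup F] [Lattice F] [IsOrderedAddMonoid F] :
    IsOrderedAddMonoid (WithAbsNorm F) :=
  inferInstanceAs (IsOrderedAddMonoid F)

instance [AddCommGroup F] [Module ℝ F] [Lattice F] [IsOrderedModule ℝ F] :
    IsOrderedModule ℝ (WithAbsNorm F) :=
  inferInstanceAs (IsOrderedModule ℝ F)

variable (F) in
/-- The identity map from the renormed lattice to the original one. -/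
def linearEquiv [AddCommGroup F] [Module ℝ F] : WithAbsNorm F ≃ₗ[ℝ] F :=
  LinearEquiv.refl ℝ F

theorem linearEquiv_abs [AddCommGroup F] [Module ℝ F] [Lattice F] (x : WithAbsNorm F) :
    linearEquiv F |x| = |linearEquiv F x| :=
  rfl

variable [NormedAddCommGroup F] [NormedSpace ℝ F] [Lattice F] [IsOrderedAddMonoid F]
  [HasMonotoneNorm F]

theorem norm_linearEquiv_abs_le {x y : WithAbsNorm F} (h : |x| ≤ y) :
    ‖linearEquiv F |x|‖ ≤ ‖linearEquiv F y‖ :=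
  norm_abs_le_norm_of_abs_le (x := linearEquiv F x) h

instance : NormedAddCommGroup (WithAbsNorm F) :=
  AddGroupNorm.toNormedAddCommGroup
    { toFun := fun x => ‖linearEquiv F |x|‖
      map_zero' := by simp only [abs_zero, map_zero, norm_zero]
      add_le' := fun x y => (norm_linearEquiv_abs_le (abs_add_le x y)).trans <| by
        rw [map_add]
        exact norm_add_le _ _
      neg' := fun x => by rw [abs_neg]
      eq_zero_of_map_eq_zero' := fun x hx => by
        have hle : ‖linearEquiv F x‖ ≤ 3 * ‖linearEquiv F |x|‖ := norm_le_three_mul_norm_abs _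
        rw [hx, mul_zero, norm_le_zero_iff] at hle
        exact (linearEquiv F).map_eq_zero_iff.1 hle }

theorem norm_def (x : WithAbsNorm F) : ‖x‖ = ‖linearEquiv F |x|‖ :=
  rfl

theorem norm_linearEquiv_le (x : WithAbsNorm F) : ‖linearEquiv F x‖ ≤ 3 * ‖x‖ :=
  norm_le_three_mul_norm_abs (linearEquiv F x)

instance : HasSolidNorm (WithAbsNorm F) where
  solid _ _ h := norm_linearEquiv_abs_le h

variable [OrderClosedTopology F] [CompleteSpace F]

theorem exists_tendsto_sum_of_summable_norm {u : ℕ → WithAbsNorm F}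
    (hu : Summable fun n => ‖u n‖) :
    ∃ s, Tendsto (fun n => ∑ k ∈ Finset.range n, u k) atTop (𝓝 s) := by
  let v (n : ℕ) : F := linearEquiv F (u n)
  have habs : Summable fun n => |v n| := Summable.of_norm hu
  have hv : Summable v :=
    Summable.of_norm_bounded (hu.mul_left 3) fun n => norm_linearEquiv_le (u n)
  have hbound (n : ℕ) : ‖∑ k ∈ Finset.range n, u k - (linearEquiv F).symm (∑' k, v k)‖ ≤
      ‖∑' k, |v (k + n)|‖ := by
    rw [norm_def, linearEquiv_abs, map_sub, map_sum, LinearEquiv.apply_symm_apply]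
    exact norm_abs_le_norm_of_abs_le (abs_sum_range_sub_tsum_le hv habs n)
  have htail : Tendsto (fun n => ‖∑' k, |v (k + n)|‖) atTop (𝓝 0) :=
    tendsto_zero_iff_norm_tendsto_zero.1 (tendsto_sum_nat_add fun n => |v n|)
  exact ⟨(linearEquiv F).symm (∑' k, v k), tendsto_iff_norm_sub_tendsto_zero.2 <|
    squeeze_zero (fun _ => norm_nonneg _) hbound htail⟩

instance : CompleteSpace (WithAbsNorm F) :=
  NormedAddCommGroup.completeSpace_of_summable_imp_tendsto fun _ =>
    exists_tendsto_sum_of_summable_norm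

variable [IsOrderedModule ℝ F]

instance : NormedSpace ℝ (WithAbsNorm F) where
  norm_smul_le c x := by
    rw [norm_def, norm_def, abs_smul_of_posSMulMono, map_smul, norm_smul, Real.norm_eq_abs,
      abs_abs, Real.norm_eq_abs]

variable (F) in
/-- The identity map as an isomorphism of Banach spaces, by the open mapping theorem. -/
noncomputable def continuousLinearEquiv : WithAbsNorm F ≃L[ℝ] F :=
  (linearEquiv F).toContinuousLinearEquivOfContinuous
    (AddMonoidHomClass.continuous_of_bound (linearEquiv F) 3 norm_linearEquiv_le)

theorem continuousLinearEquiv_le_continuousLinearEquiv {x y : WithAbsNorm F} :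
    continuousLinearEquiv F x ≤ continuousLinearEquiv F y ↔ x ≤ y :=
  Iff.rfl

theorem isLUB_continuousLinearEquiv_abs (x : WithAbsNorm F) :
    IsLUB {continuousLinearEquiv F x, -continuousLinearEquiv F x}
      (continuousLinearEquiv F |x|) :=
  isLUB_pair

theorem norm_continuousLinearEquiv_abs (x : WithAbsNorm F) :
    ‖continuousLinearEquiv F |x|‖ = ‖x‖ :=
  rfl

end WithAbsNorm

theorem mainTheorem11 {E : Type u} [NormedAddCommGroup E] [NormedSpace ℝ E] [Lattice E]
    [IsOrderedAddMonoid E] [IsOrderedModule ℝ E] [HasSolidNorm E] [CompleteSpace E]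
    (T : E →L[ℝ] E) (hT : UoDemiDunfordPettis T) (hK : IsRieszSpace (fixedSpace T)) :
    PositiveSchurProperty (fixedSpace T) ∧
    ∃ (X : Type u) (_ : NormedAddCommGroup X) (_ : NormedSpace ℝ X) (_ : Lattice X)
      (_ : IsOrderedAddMonoid X) (_ : IsOrderedModule ℝ X) (_ : HasSolidNorm X)
      (_ : CompleteSpace X) (e : X ≃L[ℝ] fixedSpace T),
      (∀ x y : X, e x ≤ e y ↔ x ≤ y) ∧
      (IsRieszSubspace (fixedSpace T) → ∀ x : X, ‖e x‖ = ‖x‖) ∧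
      PositiveSchurProperty X := by
  have hschur : PositiveSchurProperty (fixedSpace T) :=
    fun _ _ hweak => hT.tendsto_norm_of_weaklyNull hweak
  have : CompleteSpace (fixedSpace T) :=
    (ContinuousLinearMap.id ℝ E - T).isClosed_ker.completeSpace_coe
  let _ : Lattice (fixedSpace T) := hK.toLattice
  let e := WithAbsNorm.continuousLinearEquiv (fixedSpace T)
  have hle (x y : WithAbsNorm (fixedSpace T)) : e x ≤ e y ↔ x ≤ y :=
    WithAbsNorm.continuousLinearEquiv_le_continuousLinearEquiv
  have hnorm (hR : IsRieszSubspace (fixedSpace T)) (x : WithAbsNorm (fixedSpace T)) :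
      ‖e x‖ = ‖x‖ := by
    rw [← WithAbsNorm.norm_continuousLinearEquiv_abs]
    exact (hR.norm_eq_of_isLUB (WithAbsNorm.isLUB_continuousLinearEquiv_abs x)).symm
  exact ⟨hschur, WithAbsNorm (fixedSpace T), inferInstance, inferInstance, inferInstance,
    inferInstance, inferInstance, inferInstance, inferInstance, e, hle, hnorm,
    hschur.of_isInducing (e : WithAbsNorm (fixedSpace T) →L[ℝ] fixedSpace T)
      (fun x y => (hle x y).2) e.toHomeomorph.isInducing⟩
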